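/- Let $M$ be a closed, connected, oriented $3$-manifold with an oriented triangulation $\mathcal T$: $M$ is the quotient of a finite disjoint union of oriented tetrahedra by an orientation-reversing affine pairing of their faces. Suppose that $\mathcal T$ is simplicial, in the sense that every $3$-simplex of $\mathcal T$ has four distinct vertices in $M$. Let $Q$ be the set of normal quadrilaterals of $\mathcal T$; each tetrahedron contains three of them, one for each pair of opposite edges, and its orientation induces a cyclic order $q_1\to q_2\to q_3\to q_1$ on them. For $q\in Q$ and an edge $e$ of $\mathcal T$ let $i(q,e)$ be the number of edges of the tetrahedron of $q$ that face $q$ and are identified to $e$. The parameter space $\mathrm{Par}(M)$ is the set of solutions of the hyperbolic gluing equations, that is, of all $Z=(z_q)\in(\mathbb C\setminus\{0,1\})^Q$ such that (a) $\prod_{q\in Q} z_q^{\,i(q,e)}=1$ for every edge $e$ of $\mathcal T$, and (b) $z_{q_{i+1}}=\frac{1}{1-z_{q_i}}$ for every tetrahedron with cyclically ordered quadrilaterals $q_1\to q_2\to q_3\to q_1$. A pseudo-developing map of $Z\in\mathrm{Par}(M)$ is a map $D:\widetilde M\to\overline{\mathbb H^3}=\mathbb H^3\cup S^2_\infty$ on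 the universal cover that takes every $3$-simplex of the induced triangulation $\widetilde{\mathcal T}$ to an ideal straight simplex with distinct ideal vertices $v_1,\dots,v_4\in S^2_\infty=\mathbb C\cup\{\infty\}$ whose shape parameters are given by $Z$: the parameter $z_q$ of the quadrilateral $q$ facing the edge $v_iv_j$ is the cross-ratio $$(v_i,v_j;v_k,v_l)=\frac{v_i-v_k}{v_i-v_l}\cdot\frac{v_j-v_l}{v_j-v_k},$$ where $(i,j,k,l)$ is an even permutation of the positively ordered vertices $(1,2,3,4)$. A representation $\rho:\pi_1(M)\to \mathrm{PSL}(2,\mathbb C)$ is an associated representation $\rho_Z$ of $Z$ if some pseudo-developing map $D$ of $Z$ satisfies $D(\gamma\cdot p)=\rho(\gamma)\cdot D(p)$ for all $\gamma\in\pi_1(M)$ and $p\in\widetilde M$. (The map $D$, and with it $\rho_Z$, is determined by $Z$ up to the choice of an element of $\mathrm{PSL}(2,\mathbb C)$.) Theorem. For every representation $\rho:\pi_1(M)\to\mathrm{PSL}(2,\mathbb C)$ there is $Z\in\mathrm{Par}(M)$ such that $\rho$ is an associated representation $\rho_Z$ of $Z$. In other words, the Yoshida map $Y:\mathrm{Par}(M)\to\mathrm{Rep}(M)$,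 $Z\mapsto\rho_Z$, is surjective. -/

import Mathlib

open scoped MatrixGroups ComplexOrder

/-! ### Compactified hyperbolic 3-space -/

/-- Nonzero positive semidefinite Hermitian `2 × 2` matrices (the closed future light cone of
Minkowski space, without its apex). -/
def PSDForm : Type :=
  {H : Matrix (Fin 2) (Fin 2) ℂ // H.PosSemidef ∧ H ≠ 0}

/-- Two such matrices are equivalent if they differ by a positive real factor. -/
def PSDForm.setoid : Setoid PSDForm where
  r H K := ∃ c : ℝ, 0 < c ∧ K.1 = c • H.1
  iseqv :=
    { refl := fun H => ⟨1, one_pos, by simp⟩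
      symm := by
        rintro H K ⟨c, hc, h⟩
        exact ⟨c⁻¹, inv_pos.2 hc, by rw [h, smul_smul, inv_mul_cancel₀ hc.ne', one_smul]⟩
      trans := by
        rintro H K L ⟨c, hc, h⟩ ⟨d, hd, h'⟩
        exact ⟨d * c, mul_pos hd hc, by rw [h', h, smul_smul]⟩ }

/-- The compactification `ℍ³ ∪ S²_∞` of hyperbolic 3-space, in the projective Hermitian model:
nonzero positive semidefinite Hermitian `2 × 2` matrices up to positive scalars. The positive
definite classes form `ℍ³`, and the classes of rank one form the sphere at infinity `S²_∞ = ℂP¹`,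
the class of `v vᴴ` being the point with homogeneous coordinates `v ∈ ℂ²`. -/
def ClosedH3 : Type := Quotient PSDForm.setoid

/-- The action of `A ∈ SL(2, ℂ)` on positive semidefinite matrices, `H ↦ A H Aᴴ`. -/
def PSDForm.act (A : SL(2, ℂ)) (H : PSDForm) : PSDForm :=
  ⟨A.1 * H.1 * A.1.conjTranspose, H.2.1.mul_mul_conjTranspose_same A.1, by
    intro h
    apply H.2.2
    have hA : IsUnit A.1 := (Matrix.isUnit_iff_isUnit_det _).2 (by simp [A.2])
    have hA' : IsUnit A.1.conjTranspose :=
      (Matrix.isUnit_iff_isUnit_det _).2 (by simp [Matrix.det_conjTranspose, A.2])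
    have h1 : A.1 * H.1 = 0 := hA'.mul_left_eq_zero.1 h
    exact hA.mul_right_eq_zero.1 h1⟩

instance : MulAction SL(2, ℂ) ClosedH3 where
  smul A := Quotient.map' (s₁ := PSDForm.setoid) (s₂ := PSDForm.setoid) (PSDForm.act A) (by
    rintro H K ⟨c, hc, h⟩
    exact ⟨c, hc, by simp [PSDForm.act, h]⟩)
  one_smul := by
    rintro ⟨H⟩
    exact Quotient.sound (s := PSDForm.setoid) ⟨1, one_pos, by simp [PSDForm.act]⟩
  mul_smul := by
    rintro A B ⟨H⟩
    exact Quotient.sound (s := PSDForm.setoid)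
      ⟨1, one_pos, by simp [PSDForm.act, Matrix.mul_assoc]⟩

theorem ClosedH3.center_le_ker :
    Subgroup.center SL(2, ℂ) ≤ (MulAction.toPermHom SL(2, ℂ) ClosedH3).ker := by
  intro A hA
  obtain ⟨r, hr, hrA⟩ := Matrix.SpecialLinearGroup.mem_center_iff.1 hA
  have hr2 : r ^ 2 = 1 := by simpa using hr
  rw [MonoidHom.mem_ker]
  ext ⟨H⟩
  refine Quotient.sound (s := PSDForm.setoid) ⟨1, one_pos, ?_⟩
  change H.1 = (1 : ℝ) • (A.1 * H.1 * A.1.conjTranspose)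
  have hA1 : A.1 = Matrix.scalar (Fin 2) r := hrA.symm
  have h1 : r = 1 ∨ r = -1 := by simpa using hr2
  rw [hA1]
  rcases h1 with rfl | rfl
  · simp
  · have h2 : Matrix.scalar (Fin 2) (-1 : ℂ) = -1 := by rw [map_neg, map_one]
    rw [h2]
    simp

/-- The action of `PSL(2, ℂ)` on `ℍ³ ∪ S²_∞` (induced by `H ↦ A H Aᴴ`; on the sphere at infinity
it is the action by Möbius transformations). -/
instance : MulAction PSL(2, ℂ) ClosedH3 :=
  MulAction.compHom _
    (QuotientGroup.lift (Subgroup.center SL(2, ℂ)) (MulAction.toPermHom SL(2, ℂ) ClosedH3)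
      ClosedH3.center_le_ker)

theorem ClosedH3.coe_smul (A : SL(2, ℂ)) (p : ClosedH3) : (A : PSL(2, ℂ)) • p = A • p := rfl

/-! ### Ideal tetrahedra -/

/-- The determinant of two vectors of `ℂ²`; for `v = (x, 1)` and `w = (y, 1)` it is `x - y`. -/
def det2 (v w : Fin 2 → ℂ) : ℂ := v 0 * w 1 - v 1 * w 0

/-- The cross-ratio `(a, b; c, d) = (a - c)/(a - d) · (b - d)/(b - c)` of four points of `ℂP¹`, in
homogeneous coordinates. -/
noncomputable def crossRatio (a b c d : Fin 2 → ℂ) : ℂ :=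
  (det2 a c / det2 a d) * (det2 b d / det2 b c)

theorem crossRatio_affine (a b c d : ℂ) :
    crossRatio ![a, 1] ![b, 1] ![c, 1] ![d, 1] = (a - c) / (a - d) * ((b - d) / (b - c)) := by
  simp [crossRatio, det2]

/-- `∑ i, x i • (v i) (v i)ᴴ`, a positive semidefinite matrix for `x` in the standard simplex. -/
noncomputable def idealSum (v : Fin 4 → Fin 2 → ℂ) (x : stdSimplex ℝ (Fin 4)) :
    Matrix (Fin 2) (Fin 2) ℂ :=
  ∑ i, x i • Matrix.vecMulVec (v i) (star (v i))

theorem idealSum_posSemidef (v : Fin 4 → Fin 2 → ℂ) (x : stdSimplex ℝ (Fin 4)) :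
    (idealSum v x).PosSemidef :=
  Matrix.posSemidef_sum _ fun i _ =>
    (Matrix.posSemidef_vecMulVec_self_star (v i)).smul (stdSimplex.zero_le x i)

theorem idealSum_ne_zero (v : Fin 4 → Fin 2 → ℂ) (hv : ∀ i, v i ≠ 0)
    (x : stdSimplex ℝ (Fin 4)) : idealSum v x ≠ 0 := by
  intro h
  have h0 : ∀ i ∈ Finset.univ,
      0 ≤ x i • (Matrix.vecMulVec (v i) (star (v i)) : Matrix (Fin 2) (Fin 2) ℂ).trace := by
    intro i _
    exact smul_nonneg (stdSimplex.zero_le x i)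
      (Matrix.posSemidef_vecMulVec_self_star (v i)).trace_nonneg
  have ht : ∑ i, x i • (Matrix.vecMulVec (v i) (star (v i)) :
      Matrix (Fin 2) (Fin 2) ℂ).trace = 0 := by
    have := congrArg Matrix.trace h
    simpa [idealSum, Matrix.trace_sum, Matrix.trace_smul] using this
  have hz := (Finset.sum_eq_zero_iff_of_nonneg h0).1 ht
  have hx : ∀ i, x i = 0 := by
    intro i
    rcases smul_eq_zero.1 (hz i (Finset.mem_univ i)) with h1 | h1
    · exact h1
    · exact absurd (dotProduct_self_star_eq_zero.1
        ((Matrix.trace_vecMulVec _ _).symm.trans h1)) (hv i)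
  have := stdSimplex.sum_eq_one x
  simp [hx] at this

/-- The ideal straight 3-simplex `Δ³ → ℍ³ ∪ S²_∞` in barycentric coordinates: the straight simplex
spanned by the lightlike vectors `v i (v i)ᴴ`. Its ideal vertices are the points of `ℂP¹` with
homogeneous coordinates `v i`. (Rescaling the `v i` reparametrizes the simplex; all the
parametrizations that are limits of straight simplices of `ℍ³` are of this form.) -/
noncomputable def idealSimplex (v : Fin 4 → Fin 2 → ℂ) (hv : ∀ i, v i ≠ 0)
    (x : stdSimplex ℝ (Fin 4)) : ClosedH3 :=
  Quotient.mk PSDForm.setoid ⟨idealSum v x, idealSum_posSemidef v x, idealSum_ne_zero v hv x⟩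

/-! ### Triangulated closed oriented 3-manifolds -/

/-- An orientation reversing pairing of the faces of a family of tetrahedra indexed by `Tet`. The
vertices of each tetrahedron are labelled by `Fin 4`, so that the order `0, 1, 2, 3` is positive,
and its faces are labelled by the opposite vertices. The face `i` of `t` is glued to a face of
`adj t i` by the affine map that sends the vertex `j ≠ i` of `t` to the vertex `glue t i j` of
`adj t i`; the permutation `glue t i` sends `i` to the label of the target face. -/
structure FacePairing (Tet : Type*) where
  adj : Tet → Fin 4 → Tet
  glue : Tet → Fin 4 → Equiv.Perm (Fin 4)
  adj_adj : ∀ t i, adj (adj t i) (glue t i i) = t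
  glue_glue : ∀ t i, glue (adj t i) (glue t i i) = (glue t i)⁻¹
  /-- no face is glued to itself -/
  face_ne : ∀ t i, ¬ (adj t i = t ∧ glue t i i = i)
  /-- the gluing reverses the orientations of the faces -/
  sign_glue : ∀ t i, Equiv.Perm.sign (glue t i) = -1

/-- The identification of a point on a face of a tetrahedron with a point on the paired face. -/
def FacePairing.PointStep {Tet : Type*} (P : FacePairing Tet)
    (p q : Σ _ : Tet, stdSimplex ℝ (Fin 4)) : Prop :=
  ∃ i, p.2 i = 0 ∧ q.1 = P.adj p.1 i ∧ ∀ j, q.2 (P.glue p.1 i j) = p.2 j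

/-- An oriented (singular, that is, semi-simplicial) triangulation of `M` with set of 3-simplices
`Tet`: an identification of `M` with the quotient space of a disjoint union of oriented tetrahedra
by an orientation reversing pairing of their faces. -/
structure OrientedTriangulation (Tet : Type*) (M : Type*) [TopologicalSpace M] extends
    FacePairing Tet where
  proj : (Σ _ : Tet, stdSimplex ℝ (Fin 4)) → M
  isQuotientMap_proj : Topology.IsQuotientMap proj
  proj_eq_iff : ∀ p q, proj p = proj q ↔ Relation.EqvGen toFacePairing.PointStep p q

namespace OrientedTriangulation

variable {Tet : Type*} {M : Type*} [TopologicalSpace M] (T : OrientedTriangulation Tet M)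

/-- The triangulation is simplicial: every 3-simplex has four distinct vertices in `M`. -/
def IsSimplicial : Prop :=
  ∀ t, Function.Injective fun i : Fin 4 => T.proj ⟨t, stdSimplex.vertex i⟩

/-- The edges of the tetrahedra before gluing: a tetrahedron with a pair of its vertices. -/
abbrev TetEdge (_T : OrientedTriangulation Tet M) : Type _ :=
  Tet × {s : Finset (Fin 4) // s.card = 2}

/-- The identification of an edge of a face of a tetrahedron with an edge of the paired face. -/
def EdgeStep (a b : T.TetEdge) : Prop :=
  ∃ i, i ∉ a.2.1 ∧ b.1 = T.adj a.1 i ∧ b.2.1 = a.2.1.map (T.glue a.1 i).toEmbedding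

/-- The edges of the triangulation. -/
def Edge : Type _ := Quot T.EdgeStep

/-- The normal quadrilaterals of the triangulation. The quadrilateral `(t, k)` is the one in `t`
that separates the vertices `0, k + 1` from the other two; hence in every `t` the cyclic order
induced by the orientation on the quadrilaterals is `(t, 0) → (t, 1) → (t, 2) → (t, 0)`. -/
abbrev Quad (_T : OrientedTriangulation Tet M) : Type _ := Tet × Fin 3

/-- The quadrilateral with label `k` faces the edge `s` of its tetrahedron, that is, it separates
`s` from the opposite edge. -/
def Faces (k : Fin 3) (s : Finset (Fin 4)) : Prop :=
  s = {0, k.succ} ∨ s = {0, k.succ}ᶜ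

/-- The index `i(q, e)`: the number of edges of the tetrahedron of `q` that face `q` and are
identified to `e`. -/
noncomputable def index (q : T.Quad) (e : T.Edge) : ℕ :=
  Set.ncard {s : {s : Finset (Fin 4) // s.card = 2} |
    Faces q.2 s.1 ∧ Quot.mk T.EdgeStep (q.1, s) = e}

/-- The parameter space: the solutions of the hyperbolic gluing equations. -/
def parameterSpace [Fintype Tet] : Set (T.Quad → ℂ) :=
  {Z | (∀ q, Z q ≠ 0 ∧ Z q ≠ 1) ∧
    (∀ e : T.Edge, ∏ q : T.Quad, Z q ^ T.index q e = 1) ∧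
    ∀ (t : Tet) (k : Fin 3), Z (t, k + 1) = 1 / (1 - Z (t, k))}

end OrientedTriangulation

/-! ### The universal cover and the associated representation -/

/-- The universal cover of a (nice, connected) space `M`: homotopy classes of paths in `M` that
start at the base point. -/
def UniversalCover (M : Type*) [TopologicalSpace M] (x₀ : M) : Type _ :=
  Σ y : M, Path.Homotopic.Quotient x₀ y

/-- The deck transformation action of the fundamental group on the universal cover. In Mathlib's
fundamental group `γ * δ` is the loop `δ` followed by the loop `γ`, so that `γ` has to act by
precomposition with the inverse loop to give a left action. -/
noncomputable instance (M : Type*) [TopologicalSpace M] (x₀ : M) :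
    MulAction (FundamentalGroup M x₀) (UniversalCover M x₀) where
  smul γ p := ⟨p.1, (FundamentalGroup.toPath γ⁻¹).trans p.2⟩
  one_smul p := by
    change (⟨p.1, (FundamentalGroup.toPath 1⁻¹).trans p.2⟩ : UniversalCover M x₀) = p
    rw [inv_one]
    exact congrArg (Sigma.mk p.1) (CategoryTheory.Category.id_comp
      (X := FundamentalGroupoid.mk x₀) (Y := FundamentalGroupoid.mk p.1) p.2)
  mul_smul γ δ p := by
    change (⟨p.1, (FundamentalGroup.toPath (γ * δ)⁻¹).trans p.2⟩ : UniversalCover M x₀) =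
      ⟨p.1, (FundamentalGroup.toPath γ⁻¹).trans ((FundamentalGroup.toPath δ⁻¹).trans p.2)⟩
    rw [mul_inv_rev]
    exact congrArg (Sigma.mk p.1) (CategoryTheory.Category.assoc
      (W := FundamentalGroupoid.mk x₀) (X := FundamentalGroupoid.mk x₀)
      (Y := FundamentalGroupoid.mk x₀) (Z := FundamentalGroupoid.mk p.1) γ⁻¹ δ⁻¹ p.2)

/-- The straight segment from `x` to `y` in the standard simplex. -/
noncomputable def simplexSegment (x y : stdSimplex ℝ (Fin 4)) : Path x y where
  toFun s := ⟨AffineMap.lineMap x.1 y.1 (s : ℝ),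
    (convex_stdSimplex ℝ (Fin 4)).lineMap_mem x.2 y.2 s.2⟩
  continuous_toFun :=
    Continuous.subtype_mk (AffineMap.lineMap_continuous.comp continuous_subtype_val) _
  source' := by ext; simp
  target' := by ext; simp

namespace OrientedTriangulation

variable {Tet : Type*} {M : Type*} [TopologicalSpace M] (T : OrientedTriangulation Tet M)

/-- The characteristic map `Δ³ → M` of a 3-simplex. -/
def charMap (t : Tet) : C(stdSimplex ℝ (Fin 4), M) where
  toFun x := T.proj ⟨t, x⟩
  continuous_toFun := T.isQuotientMap_proj.continuous.comp continuous_sigmaMk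

/-- The lift to the universal cover of the characteristic map of `t` that sends the vertex `0` to
the point `a` over it. These are the 3-simplices of the induced triangulation of the universal
cover. -/
noncomputable def liftSimplex {x₀ : M} (t : Tet)
    (a : Path.Homotopic.Quotient x₀ (T.charMap t (stdSimplex.vertex 0)))
    (x : stdSimplex ℝ (Fin 4)) : UniversalCover M x₀ :=
  ⟨T.charMap t x, a.trans
    (Path.Homotopic.Quotient.map
      (Path.Homotopic.Quotient.mk (simplexSegment (stdSimplex.vertex 0) x)) (T.charMap t))⟩

/-- `D` is a pseudo-developing map of `Z`: it takes each 3-simplex of the universal cover to an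
ideal straight simplex with pairwise distinct vertices `v 0, …, v 3 ∈ ℂP¹` whose shape parameter
at the edge `v i v j` is the value of `Z` at the quadrilateral facing that edge. Here the shape
parameter at `v i v j` is the cross-ratio `(v i, v j; v k, v l)`, for `(i, j, k, l)` an even
permutation of the vertices. (Such a map is continuous, since its restriction to every simplex
is.) -/
def IsPseudoDevelopingMap (x₀ : M) (Z : T.Quad → ℂ) (D : UniversalCover M x₀ → ClosedH3) : Prop :=
  ∀ (t : Tet) (a : Path.Homotopic.Quotient x₀ (T.charMap t (stdSimplex.vertex 0))),
    ∃ (v : Fin 4 → Fin 2 → ℂ) (hv : ∀ i, v i ≠ 0),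
      (∀ i j, i ≠ j → det2 (v i) (v j) ≠ 0) ∧
      (∀ x, D (T.liftSimplex t a x) = idealSimplex v hv x) ∧
      ∀ σ : Equiv.Perm (Fin 4), Equiv.Perm.sign σ = 1 → ∀ k : Fin 3, Faces k {σ 0, σ 1} →
        Z (t, k) = crossRatio (v (σ 0)) (v (σ 1)) (v (σ 2)) (v (σ 3))

/-- `ρ` is an associated representation `ρ_Z` of `Z`: some pseudo-developing map of `Z` is
equivariant with respect to `ρ`. (A pseudo-developing map of `Z` is unique up to composition with
an element of `PSL(2, ℂ)`, and `ρ_Z` is defined up to the corresponding conjugation.) -/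
def IsAssociatedRepresentation (x₀ : M) (Z : T.Quad → ℂ)
    (ρ : FundamentalGroup M x₀ →* PSL(2, ℂ)) : Prop :=
  ∃ D : UniversalCover M x₀ → ClosedH3, T.IsPseudoDevelopingMap x₀ Z D ∧
    ∀ (γ : FundamentalGroup M x₀) (p : UniversalCover M x₀), D (γ • p) = ρ γ • D p

end OrientedTriangulation

/-! A pseudo-developing map is determined by where it sends the vertices of the universal cover, so
it suffices to choose vectors in `ℂ²` there, equivariantly up to sign and pairwise independent on
each tetrahedron. The fundamental group acts freely, so the vector at one point of each orbit can be
prescribed arbitrarily. Simpliciality puts the vertices of a tetrahedron in different orbits, so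
each independence condition is a nonzero polynomial in the free vectors. One lift per tetrahedron
gives finitely many conditions, and these can be met together (`exists_isVertexDecoration`).

The cross-ratios of the chosen vectors are insensitive to signs and to `SL(2, ℂ)`, so they descend
to parameters on the quadrilaterals. They satisfy the gluing equations
(`exists_parameter_of_isVertexDecoration`): the cyclic relation is a Plücker identity, and around an
edge each parameter is a quotient of consecutive terms, so the product telescopes.

Extending straight over simplices gives the equivariant map
(`isAssociatedRepresentation_of_isVertexDecoration`). -/

/-! ### Lifted simplices in the universal cover. -/

instance : ContractibleSpace (stdSimplex ℝ (Fin 4)) :=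
  (convex_stdSimplex ℝ (Fin 4)).contractibleSpace ⟨_, (stdSimplex.vertex (S := ℝ) (0 : Fin 4)).2⟩

/-- Extending equal points of the universal cover along pointwise equal paths gives equal points. -/
theorem UniversalCover.extend_congr {M : Type*} [TopologicalSpace M] {x₀ : M}
    {p p' : UniversalCover M x₀} (h : p = p') {y y' : M} (γ : Path p.1 y) (γ' : Path p'.1 y')
    (hγ : ∀ s, γ s = γ' s) :
    (⟨y, p.2.trans (Path.Homotopic.Quotient.mk γ)⟩ : UniversalCover M x₀) =
      ⟨y', p'.2.trans (Path.Homotopic.Quotient.mk γ')⟩ := by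
  subst h
  obtain rfl : y = y' := by simpa using hγ 1
  obtain rfl : γ = γ' := Path.ext (funext hγ)
  rfl

/-- The simplex is contractible, so paths in it with the same endpoints are homotopic. -/
theorem trans_map_simplexSegment_trans {M : Type*} [TopologicalSpace M] {x₀ : M}
    (f : C(stdSimplex ℝ (Fin 4), M)) {z : stdSimplex ℝ (Fin 4)}
    (a : Path.Homotopic.Quotient x₀ (f z)) (x y : stdSimplex ℝ (Fin 4)) :
    (a.trans (Path.Homotopic.Quotient.map (Path.Homotopic.Quotient.mk (simplexSegment z x)) f)).trans
        (Path.Homotopic.Quotient.mk ((simplexSegment x y).map f.continuous)) =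
      a.trans (Path.Homotopic.Quotient.map
        (Path.Homotopic.Quotient.mk (simplexSegment z y)) f) := by
  have h : Path.Homotopic.Quotient.mk (simplexSegment z y) =
      Path.Homotopic.Quotient.mk ((simplexSegment z x).trans (simplexSegment x y)) :=
    Subsingleton.elim _ _
  rw [Path.Homotopic.Quotient.trans_assoc, h, ← Path.Homotopic.Quotient.mk_map,
    ← Path.Homotopic.Quotient.mk_map, ← Path.Homotopic.Quotient.mk_trans, Path.map_trans]

theorem Path.Homotopic.Quotient.trans_symm_trans_cancel {M : Type*} [TopologicalSpace M]
    {x y z : M} (c : Path.Homotopic.Quotient x z) (d : Path.Homotopic.Quotient y z) :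
    (c.trans d.symm).trans d = c := by
  rw [Path.Homotopic.Quotient.trans_assoc, Path.Homotopic.Quotient.symm_trans,
    Path.Homotopic.Quotient.trans_refl]

namespace OrientedTriangulation

variable {Tet : Type*} {M : Type*} [TopologicalSpace M] (T : OrientedTriangulation Tet M)

theorem liftSimplex_eq_extend {x₀ : M} (t : Tet)
    (a : Path.Homotopic.Quotient x₀ (T.charMap t (stdSimplex.vertex 0)))
    (x y : stdSimplex ℝ (Fin 4)) :
    T.liftSimplex t a y = ⟨T.charMap t y, (T.liftSimplex t a x).2.trans
      (Path.Homotopic.Quotient.mk ((simplexSegment x y).map (T.charMap t).continuous))⟩ := by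
  refine congrArg (Sigma.mk (T.charMap t y)) ?_
  exact (trans_map_simplexSegment_trans (T.charMap t) a x y).symm

/-- Two lifted simplices that agree at a point agree along segments with the same image. -/
theorem liftSimplex_eq_of_segment {x₀ : M} {t t' : Tet}
    {a : Path.Homotopic.Quotient x₀ (T.charMap t (stdSimplex.vertex 0))}
    {a' : Path.Homotopic.Quotient x₀ (T.charMap t' (stdSimplex.vertex 0))}
    {x x' y y' : stdSimplex ℝ (Fin 4)} (h : T.liftSimplex t a x = T.liftSimplex t' a' x')
    (hs : ∀ s, T.charMap t (simplexSegment x y s) = T.charMap t' (simplexSegment x' y' s)) :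
    T.liftSimplex t a y = T.liftSimplex t' a' y' := by
  rw [T.liftSimplex_eq_extend t a x y, T.liftSimplex_eq_extend t' a' x' y']
  exact UniversalCover.extend_congr h _ _ hs

theorem liftSimplex_congr {x₀ : M} {t : Tet}
    {a a' : Path.Homotopic.Quotient x₀ (T.charMap t (stdSimplex.vertex 0))}
    {x : stdSimplex ℝ (Fin 4)} (h : T.liftSimplex t a x = T.liftSimplex t a' x)
    (y : stdSimplex ℝ (Fin 4)) : T.liftSimplex t a y = T.liftSimplex t a' y :=
  T.liftSimplex_eq_of_segment h fun _ => rfl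

theorem exists_liftSimplex_eq {x₀ : M} (t : Tet) (x : stdSimplex ℝ (Fin 4))
    (p : UniversalCover M x₀) (hp : p.1 = T.proj ⟨t, x⟩) :
    ∃ a, T.liftSimplex t a x = p := by
  obtain ⟨y, c⟩ := p
  obtain rfl : y = T.proj ⟨t, x⟩ := hp
  refine ⟨c.trans (Path.Homotopic.Quotient.map (Path.Homotopic.Quotient.mk
    (simplexSegment (stdSimplex.vertex 0) x)) (T.charMap t)).symm, ?_⟩
  refine congrArg (Sigma.mk (T.charMap t x)) ?_
  exact Path.Homotopic.Quotient.trans_symm_trans_cancel c _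

theorem exists_liftSimplex (x₀ : M) (p : UniversalCover M x₀) :
    ∃ t a x, T.liftSimplex t a x = p := by
  obtain ⟨⟨t, x⟩, h⟩ := T.isQuotientMap_proj.surjective p.1
  obtain ⟨a, ha⟩ := T.exists_liftSimplex_eq t x p h.symm
  exact ⟨t, a, x, ha⟩

theorem smul_liftSimplex {x₀ : M} (γ : FundamentalGroup M x₀) (t : Tet)
    (a : Path.Homotopic.Quotient x₀ (T.charMap t (stdSimplex.vertex 0)))
    (x : stdSimplex ℝ (Fin 4)) :
    γ • T.liftSimplex t a x = T.liftSimplex t ((FundamentalGroup.toPath γ⁻¹).trans a) x :=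
  congrArg (Sigma.mk (T.charMap t x)) (Path.Homotopic.Quotient.trans_assoc _ _ _).symm

theorem proj_eq_of_face {t : Tet} {i : Fin 4} {x x' : stdSimplex ℝ (Fin 4)} (hx : x i = 0)
    (hx' : ∀ j, x' (T.glue t i j) = x j) : T.proj ⟨t, x⟩ = T.proj ⟨T.adj t i, x'⟩ :=
  (T.proj_eq_iff _ _).2 (.rel _ _ ⟨i, hx, rfl, hx'⟩)

theorem simplexSegment_apply (x y : stdSimplex ℝ (Fin 4)) (s : unitInterval) (i : Fin 4) :
    simplexSegment x y s i = AffineMap.lineMap (x i) (y i) (s : ℝ) :=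
  AffineMap.pi_lineMap_apply x.1 y.1 (s : ℝ) i

/-- Lifts of neighbouring simplices that agree at a point of the common face agree on it. -/
theorem liftSimplex_eq_of_face {x₀ : M} {t : Tet} {i : Fin 4}
    {a : Path.Homotopic.Quotient x₀ (T.charMap t (stdSimplex.vertex 0))}
    {a' : Path.Homotopic.Quotient x₀ (T.charMap (T.adj t i) (stdSimplex.vertex 0))}
    {x x' y y' : stdSimplex ℝ (Fin 4)} (hx : x i = 0) (hx' : ∀ j, x' (T.glue t i j) = x j)
    (hy : y i = 0) (hy' : ∀ j, y' (T.glue t i j) = y j)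
    (h : T.liftSimplex t a x = T.liftSimplex (T.adj t i) a' x') :
    T.liftSimplex t a y = T.liftSimplex (T.adj t i) a' y' := by
  refine T.liftSimplex_eq_of_segment h fun s => T.proj_eq_of_face (i := i) ?_ fun j => ?_
  · rw [simplexSegment_apply, hx, hy]; simp
  · rw [simplexSegment_apply, simplexSegment_apply, hx', hy']

theorem vertex_glue (σ : Equiv.Perm (Fin 4)) (j k : Fin 4) :
    stdSimplex.vertex (S := ℝ) (σ j) (σ k) = stdSimplex.vertex (S := ℝ) j k := by
  simp [stdSimplex.vertex_coe, Pi.single_apply]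

theorem vertex_eq_zero {i j : Fin 4} (h : j ≠ i) : stdSimplex.vertex (S := ℝ) j i = 0 := by
  simp [stdSimplex.vertex_coe, h.symm]

/-- The vertices of a lifted simplex. -/
noncomputable def liftVertex {x₀ : M} (t : Tet)
    (a : Path.Homotopic.Quotient x₀ (T.charMap t (stdSimplex.vertex 0))) (i : Fin 4) :
    UniversalCover M x₀ :=
  T.liftSimplex t a (stdSimplex.vertex i)

theorem liftVertex_eq_of_face {x₀ : M} {t : Tet} {i : Fin 4}
    {a : Path.Homotopic.Quotient x₀ (T.charMap t (stdSimplex.vertex 0))}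
    {a' : Path.Homotopic.Quotient x₀ (T.charMap (T.adj t i) (stdSimplex.vertex 0))}
    {x x' : stdSimplex ℝ (Fin 4)} (hx : x i = 0) (hx' : ∀ j, x' (T.glue t i j) = x j)
    (h : T.liftSimplex t a x = T.liftSimplex (T.adj t i) a' x') {j : Fin 4} (hj : j ≠ i) :
    T.liftVertex t a j = T.liftVertex (T.adj t i) a' (T.glue t i j) :=
  T.liftSimplex_eq_of_face hx hx' (vertex_eq_zero hj) (vertex_glue _ j) h

/-- A vector-valued function on the universal cover extends straight over each simplex, and the
result does not depend on the simplex that contains a point. -/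
theorem idealSum_liftVertex_congr {x₀ : M} (W : UniversalCover M x₀ → Fin 2 → ℂ) {t t' : Tet}
    {a : Path.Homotopic.Quotient x₀ (T.charMap t (stdSimplex.vertex 0))}
    {a' : Path.Homotopic.Quotient x₀ (T.charMap t' (stdSimplex.vertex 0))}
    {x x' : stdSimplex ℝ (Fin 4)} (h : T.liftSimplex t a x = T.liftSimplex t' a' x') :
    idealSum (fun i => W (T.liftVertex t a i)) x =
      idealSum (fun i => W (T.liftVertex t' a' i)) x' := by
  have key : ∀ p q : (Σ _ : Tet, stdSimplex ℝ (Fin 4)),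
      Relation.EqvGen T.toFacePairing.PointStep p q → ∀ a a',
      T.liftSimplex (x₀ := x₀) p.1 a p.2 = T.liftSimplex q.1 a' q.2 →
      idealSum (fun i => W (T.liftVertex p.1 a i)) p.2 =
        idealSum (fun i => W (T.liftVertex q.1 a' i)) q.2 := by
    intro p q hpq
    induction hpq with
    | rel p q hs =>
      obtain ⟨t, x⟩ := p
      obtain ⟨t', x'⟩ := q
      obtain ⟨i, hx, ht, hx'⟩ := hs
      dsimp only at hx ht hx'
      subst ht
      intro a a' h
      unfold idealSum
      refine Eq.trans ?_ (Equiv.sum_comp (T.glue t i) _)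
      refine Finset.sum_congr rfl fun j _ => ?_
      dsimp only
      rw [hx' j]
      by_cases hj : j = i
      · rw [hj, hx, zero_smul, zero_smul]
      · rw [T.liftVertex_eq_of_face hx hx' h hj]
    | refl p =>
      intro a a' h
      simp only [liftVertex, T.liftSimplex_congr h]
    | symm p q _ ih => exact fun a a' h => (ih a' a h.symm).symm
    | trans p q r hpq _ ih₁ ih₂ =>
      intro a a' h
      -- The intermediate simplex is lifted through the same point of the universal cover.
      obtain ⟨b, hb⟩ := T.exists_liftSimplex_eq q.1 q.2 (T.liftSimplex p.1 a p.2)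
        ((T.proj_eq_iff p q).2 hpq)
      exact (ih₁ a b hb.symm).trans (ih₂ b a' (hb.trans h))
  exact key ⟨t, x⟩ ⟨t', x'⟩ ((T.proj_eq_iff _ _).1 (congrArg Sigma.fst h)) a a' h

end OrientedTriangulation

/-! ### Cross-ratios and even labellings. -/

theorem det2_mulVec (A : Matrix (Fin 2) (Fin 2) ℂ) (v w : Fin 2 → ℂ) :
    det2 (A.mulVec v) (A.mulVec w) = A.det * det2 v w := by
  simp only [det2, Matrix.mulVec, dotProduct, Fin.sum_univ_two, Matrix.det_fin_two]
  ring

theorem det2_mulVec_sl (A : SL(2, ℂ)) (v w : Fin 2 → ℂ) :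
    det2 (A.1.mulVec v) (A.1.mulVec w) = det2 v w := by
  rw [det2_mulVec, A.2, one_mul]

theorem det2_swap (v w : Fin 2 → ℂ) : det2 w v = -det2 v w := by
  unfold det2; ring

theorem det2_smul_smul (c d : ℂ) (v w : Fin 2 → ℂ) : det2 (c • v) (d • w) = c * d * det2 v w := by
  simp only [det2, Pi.smul_apply, smul_eq_mul]; ring

theorem crossRatio_smul {c : Fin 4 → ℂ} (hc : ∀ i, c i ≠ 0) (v : Fin 4 → Fin 2 → ℂ)
    (i j k l : Fin 4) :
    crossRatio (c i • v i) (c j • v j) (c k • v k) (c l • v l) =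
      crossRatio (v i) (v j) (v k) (v l) := by
  have hi := hc i
  have hj := hc j
  have hk := hc k
  have hl := hc l
  simp only [crossRatio, det2_smul_smul, div_mul_div_comm]
  rw [show c i * c k * det2 (v i) (v k) * (c j * c l * det2 (v j) (v l)) =
      c i * c k * c j * c l * (det2 (v i) (v k) * det2 (v j) (v l)) by ring,
    show c i * c l * det2 (v i) (v l) * (c j * c k * det2 (v j) (v k)) =
      c i * c k * c j * c l * (det2 (v i) (v l) * det2 (v j) (v k)) by ring,
    mul_div_mul_left _ _ (by simp [*])]

theorem crossRatio_mulVec (A : SL(2, ℂ)) (a b c d : Fin 2 → ℂ) :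
    crossRatio (A.1.mulVec a) (A.1.mulVec b) (A.1.mulVec c) (A.1.mulVec d) =
      crossRatio a b c d := by
  simp only [crossRatio, det2_mulVec_sl]

theorem crossRatio_comm_pairs (a b c d : Fin 2 → ℂ) : crossRatio b a d c = crossRatio a b c d := by
  simp only [crossRatio]; ring

theorem crossRatio_swap_pairs (a b c d : Fin 2 → ℂ) : crossRatio c d a b = crossRatio a b c d := by
  simp only [crossRatio, det2_swap a c, det2_swap b d, det2_swap b c, det2_swap a d]
  rw [div_mul_div_comm, div_mul_div_comm]
  congr 1 <;> ring

/-- The Plücker relation among the six determinants of four vectors. It also shows that the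
parameter avoids `1` in general position. -/
theorem one_sub_crossRatio {a b c d : Fin 2 → ℂ} (h₁ : det2 a d ≠ 0) (h₂ : det2 b c ≠ 0) :
    1 - crossRatio a b c d = -(det2 a b * det2 c d) / (det2 a d * det2 b c) := by
  rw [crossRatio, div_mul_div_comm, eq_div_iff (mul_ne_zero h₁ h₂), sub_mul,
    div_mul_cancel₀ _ (mul_ne_zero h₁ h₂)]
  unfold det2; ring

theorem crossRatio_cyclic {a b c d : Fin 2 → ℂ} (h₁ : det2 a d ≠ 0) (h₂ : det2 b c ≠ 0) :
    crossRatio a c d b = 1 / (1 - crossRatio a b c d) := by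
  rw [one_sub_crossRatio h₁ h₂, one_div_div, crossRatio, div_mul_div_comm, det2_swap b c,
    mul_neg, neg_div, div_neg]

/-- The shape parameter at the edge `v (σ 0) v (σ 1)`, for `σ` even, depends only on the
quadrilateral facing this edge. -/
theorem crossRatio_of_faces (v : Fin 4 → Fin 2 → ℂ) (σ : Equiv.Perm (Fin 4))
    (hσ : Equiv.Perm.sign σ = 1) (k : Fin 3)
    (hk : OrientedTriangulation.Faces k {σ 0, σ 1}) :
    crossRatio (v (σ 0)) (v (σ 1)) (v (σ 2)) (v (σ 3)) =
      crossRatio (v 0) (v k.succ) (v (k + 1).succ) (v (k + 2).succ) := by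
  -- The even labellings belonging to one quadrilateral differ by the Klein four-group, which
  -- preserves the cross-ratio.
  have key : ∀ (σ : Equiv.Perm (Fin 4)), Equiv.Perm.sign σ = 1 → ∀ k : Fin 3,
      (({σ 0, σ 1} : Finset (Fin 4)) = {0, k.succ} ∨
        ({σ 0, σ 1} : Finset (Fin 4)) = {0, k.succ}ᶜ) →
      (σ 0 = 0 ∧ σ 1 = k.succ ∧ σ 2 = (k + 1).succ ∧ σ 3 = (k + 2).succ) ∨
      (σ 1 = 0 ∧ σ 0 = k.succ ∧ σ 3 = (k + 1).succ ∧ σ 2 = (k + 2).succ) ∨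
      (σ 2 = 0 ∧ σ 3 = k.succ ∧ σ 0 = (k + 1).succ ∧ σ 1 = (k + 2).succ) ∨
      (σ 3 = 0 ∧ σ 2 = k.succ ∧ σ 1 = (k + 1).succ ∧ σ 0 = (k + 2).succ) := by decide
  rcases key σ hσ k hk with ⟨h0, h1, h2, h3⟩ | ⟨h0, h1, h2, h3⟩ | ⟨h0, h1, h2, h3⟩ |
    ⟨h0, h1, h2, h3⟩ <;> rw [h0, h1, h2, h3]
  · exact crossRatio_comm_pairs _ _ _ _
  · exact crossRatio_swap_pairs _ _ _ _
  · rw [crossRatio_comm_pairs, crossRatio_swap_pairs]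

theorem exists_even_perm : ∀ a b : Fin 4, a ≠ b →
    ∃ σ : Equiv.Perm (Fin 4), Equiv.Perm.sign σ = 1 ∧ σ 0 = a ∧ σ 1 = b := by decide

/-- The only nontrivial permutation fixing `0` and `1` is a transposition, hence odd. -/
theorem even_perm_ext (σ τ : Equiv.Perm (Fin 4)) (hσ : Equiv.Perm.sign σ = 1)
    (hτ : Equiv.Perm.sign τ = 1) (h0 : σ 0 = τ 0) (h1 : σ 1 = τ 1) : σ = τ := by
  have key : ∀ π : Equiv.Perm (Fin 4), Equiv.Perm.sign π = 1 → π 0 = 0 → π 1 = 1 → π = 1 := by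
    decide
  have h := key (τ⁻¹ * σ) (by simp [hσ, hτ]) (by simp [h0]) (by simp [h1])
  exact (inv_mul_eq_one.1 h).symm

theorem existsUnique_faces : ∀ s : Finset (Fin 4), s.card = 2 →
    ∃ k, OrientedTriangulation.Faces k s ∧ ∀ k', OrientedTriangulation.Faces k' s → k' = k := by
  unfold OrientedTriangulation.Faces
  decide

/-! ### General position. -/

/-- Finitely many conditions of general position can be met by vectors of `ℂ²`. -/
theorem exists_vectors_det2_ne_zero {ι J : Type*} [Finite J] (b c : J → ι) (B C : J → SL(2, ℂ))
    (hbc : ∀ j, b j ≠ c j) :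
    ∃ v : ι → Fin 2 → ℂ, ∀ j, det2 ((B j).1.mulVec (v (b j))) ((C j).1.mulVec (v (c j))) ≠ 0 := by
  classical
  cases nonempty_fintype J
  let L (A : SL(2, ℂ)) (i : ι) (k : Fin 2) : MvPolynomial (ι × Fin 2) ℂ :=
    ∑ l, MvPolynomial.C (A.1 k l) * MvPolynomial.X (i, l)
  let P (j : J) : MvPolynomial (ι × Fin 2) ℂ :=
    L (B j) (b j) 0 * L (C j) (c j) 1 - L (B j) (b j) 1 * L (C j) (c j) 0
  have hL (A : SL(2, ℂ)) (i : ι) (k : Fin 2) (v : ι → Fin 2 → ℂ) :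
      MvPolynomial.eval (fun p => v p.1 p.2) (L A i k) = A.1.mulVec (v i) k := by
    simp [L, Matrix.mulVec, dotProduct]
  have hP (j : J) (v : ι → Fin 2 → ℂ) : MvPolynomial.eval (fun p => v p.1 p.2) (P j) =
      det2 ((B j).1.mulVec (v (b j))) ((C j).1.mulVec (v (c j))) := by
    simp only [P, map_sub, map_mul, hL, det2]
  -- Since `b j ≠ c j`, the two vectors vary independently and can be chosen so that the matrices
  -- carry them to the standard basis, where the determinant is `1`.
  have hP0 (j : J) : P j ≠ 0 := by
    intro h0
    have h := hP j (fun i => if i = b j then (B j)⁻¹.1.mulVec ![1, 0] else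
      (C j)⁻¹.1.mulVec ![0, 1])
    rw [h0, map_zero, if_pos rfl, if_neg (hbc j).symm, Matrix.mulVec_mulVec,
      Matrix.mulVec_mulVec, ← Matrix.SpecialLinearGroup.coe_mul,
      ← Matrix.SpecialLinearGroup.coe_mul, mul_inv_cancel, mul_inv_cancel] at h
    simp [det2] at h
  have hprod : ∏ j, P j ≠ 0 := Finset.prod_ne_zero_iff.2 fun j _ => hP0 j
  obtain ⟨x, hx⟩ : ∃ x, MvPolynomial.eval x (∏ j, P j) ≠ 0 := by
    by_contra! h
    exact hprod (MvPolynomial.funext fun x => by rw [h, map_zero])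
  refine ⟨fun i k => x (i, k), fun j => ?_⟩
  rw [map_prod] at hx
  refine (hP j fun i k => x (i, k)).symm.trans_ne ?_
  exact Finset.prod_ne_zero_iff.1 hx j (Finset.mem_univ j)

/-! ### Equivariance of ideal simplices and signs of lifts. -/

/-- The rank-one form `v vᴴ` does not see the sign of `v`, so equivariance of the vectors up to sign
becomes honest equivariance of the simplices. -/
theorem idealSum_mulVec (A : SL(2, ℂ)) {c : Fin 4 → ℂ} (hc : ∀ i, c i = 1 ∨ c i = -1)
    (v : Fin 4 → Fin 2 → ℂ) (x : stdSimplex ℝ (Fin 4)) :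
    idealSum (fun i => c i • A.1.mulVec (v i)) x = A.1 * idealSum v x * A.1.conjTranspose := by
  unfold idealSum
  rw [Finset.mul_sum, Finset.sum_mul]
  refine Finset.sum_congr rfl fun i _ => ?_
  rw [Matrix.mul_smul, Matrix.smul_mul]
  congr 1
  rw [Matrix.mul_vecMulVec, Matrix.vecMulVec_mul, ← Matrix.star_mulVec]
  dsimp only
  rcases hc i with h | h
  · rw [h, one_smul]
  · rw [h, neg_one_smul, star_neg, Matrix.neg_vecMulVec, Matrix.vecMulVec_neg, neg_neg]

theorem idealSimplex_congr {v v' : Fin 4 → Fin 2 → ℂ} (hv : ∀ i, v i ≠ 0) (hv' : ∀ i, v' i ≠ 0)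
    {x x' : stdSimplex ℝ (Fin 4)} (h : idealSum v x = idealSum v' x') :
    idealSimplex v hv x = idealSimplex v' hv' x' :=
  congrArg (Quotient.mk PSDForm.setoid) (Subtype.ext h)

theorem smul_idealSimplex (A : SL(2, ℂ)) {v v' : Fin 4 → Fin 2 → ℂ} (hv : ∀ i, v i ≠ 0)
    (hv' : ∀ i, v' i ≠ 0) {x : stdSimplex ℝ (Fin 4)}
    (h : idealSum v' x = A.1 * idealSum v x * A.1.conjTranspose) :
    idealSimplex v' hv' x = (A : PSL(2, ℂ)) • idealSimplex v hv x :=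
  congrArg (Quotient.mk PSDForm.setoid) (Subtype.ext h)

/-- Two elements of `SL(2, ℂ)` with the same class in `PSL(2, ℂ)` differ by a sign. -/
theorem sl_eq_or_eq_neg_of_coe_eq {A B : SL(2, ℂ)} (h : (A : PSL(2, ℂ)) = (B : PSL(2, ℂ))) :
    ∃ c : ℂ, (c = 1 ∨ c = -1) ∧ B.1 = c • A.1 := by
  have hc : A⁻¹ * B ∈ Subgroup.center SL(2, ℂ) := QuotientGroup.eq.1 h
  obtain ⟨r, hr, hrA⟩ := Matrix.SpecialLinearGroup.mem_center_iff.1 hc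
  have hr2 : r ^ 2 = 1 := by simpa using hr
  refine ⟨r, by simpa using hr2, ?_⟩
  have h1 : B = A * (A⁻¹ * B) := by group
  rw [h1, Matrix.SpecialLinearGroup.coe_mul]
  change A.1 * (A⁻¹ * B).1 = _
  have h2 : (A⁻¹ * B).1 = Matrix.scalar (Fin 2) r := hrA.symm
  rw [h2]
  ext i j
  simp [Matrix.scalar_apply, Matrix.mul_diagonal, mul_comm]

/-! ### Deck transformations: transitive on fibres and free. -/

namespace UniversalCover

variable {M : Type*} [TopologicalSpace M] {x₀ : M}

theorem smul_fst (γ : FundamentalGroup M x₀) (p : UniversalCover M x₀) : (γ • p).1 = p.1 := rfl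

theorem exists_smul_eq (p q : UniversalCover M x₀) (h : p.1 = q.1) :
    ∃ γ : FundamentalGroup M x₀, γ • p = q := by
  obtain ⟨y, c⟩ := p
  obtain ⟨z, d⟩ := q
  obtain rfl : y = z := h
  -- The inverse cancels the one built into the deck action.
  refine ⟨(FundamentalGroup.fromPath (d.trans c.symm))⁻¹, ?_⟩
  refine congrArg (Sigma.mk y) ?_
  rw [inv_inv]
  refine Eq.trans ?_ (Path.Homotopic.Quotient.trans_symm_trans_cancel d c.symm.symm)
  have hc : c.symm.symm = c := by
    induction c using Path.Homotopic.Quotient.ind with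
    | mk c => rw [← Path.Homotopic.Quotient.mk_symm, ← Path.Homotopic.Quotient.mk_symm,
        Path.symm_symm]
  rw [hc]

theorem smul_left_cancel_point {γ δ : FundamentalGroup M x₀} {p : UniversalCover M x₀}
    (h : γ • p = δ • p) : γ = δ := by
  obtain ⟨y, c⟩ := p
  have h1 : (FundamentalGroup.toPath γ⁻¹).trans c = (FundamentalGroup.toPath δ⁻¹).trans c :=
    eq_of_heq (Sigma.mk.inj h).2
  have h2 := congrArg (fun d => d.trans c.symm) h1
  simp only [Path.Homotopic.Quotient.trans_assoc, Path.Homotopic.Quotient.trans_symm,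
    Path.Homotopic.Quotient.trans_refl] at h2
  exact inv_injective h2

end UniversalCover

/-- The edge of the standard tetrahedron spanned by the first two vertices of a labelling. -/
def firstEdge (σ : Equiv.Perm (Fin 4)) : {s : Finset (Fin 4) // s.card = 2} :=
  ⟨{σ 0, σ 1}, Finset.card_pair (by simp)⟩

/-- The quadrilateral facing the edge spanned by the first two vertices of a labelling. -/
noncomputable def facingQuad (σ : Equiv.Perm (Fin 4)) : Fin 3 :=
  (existsUnique_faces (firstEdge σ).1 (firstEdge σ).2).choose

theorem faces_facingQuad (σ : Equiv.Perm (Fin 4)) :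
    OrientedTriangulation.Faces (facingQuad σ) (firstEdge σ).1 :=
  (existsUnique_faces (firstEdge σ).1 (firstEdge σ).2).choose_spec.1

theorem eq_facingQuad {σ : Equiv.Perm (Fin 4)} {k : Fin 3}
    (h : OrientedTriangulation.Faces k (firstEdge σ).1) : k = facingQuad σ :=
  (existsUnique_faces (firstEdge σ).1 (firstEdge σ).2).choose_spec.2 k h

/-! ### Equivariant vectors at the vertices. -/

namespace OrientedTriangulation

variable {Tet : Type*} {M : Type*} [TopologicalSpace M] (T : OrientedTriangulation Tet M)

theorem exists_smul_liftSimplex {x₀ : M} (t : Tet)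
    (a a' : Path.Homotopic.Quotient x₀ (T.charMap t (stdSimplex.vertex 0))) :
    ∃ γ : FundamentalGroup M x₀, ∀ x, T.liftSimplex t a' x = γ • T.liftSimplex t a x := by
  obtain ⟨γ, hγ⟩ := UniversalCover.exists_smul_eq (T.liftSimplex t a (stdSimplex.vertex 0))
    (T.liftSimplex t a' (stdSimplex.vertex 0)) rfl
  refine ⟨γ, fun x => ?_⟩
  rw [smul_liftSimplex] at hγ ⊢
  exact (T.liftSimplex_congr hγ x).symm

/-- A choice of vectors for the points of the universal cover that is equivariant up to sign and
in general position at each lifted simplex. -/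
structure IsVertexDecoration {x₀ : M} (A : FundamentalGroup M x₀ → SL(2, ℂ))
    (W : UniversalCover M x₀ → Fin 2 → ℂ) : Prop where
  equivariant : ∀ γ p, ∃ c : ℂ, (c = 1 ∨ c = -1) ∧ W (γ • p) = c • (A γ).1.mulVec (W p)
  general_position : ∀ t a i j, i ≠ j → det2 (W (T.liftVertex t a i)) (W (T.liftVertex t a j)) ≠ 0

/-- Every point is a unique deck translate of a base point over its image, so a free choice `v : M →
ℂ²` spreads to the universal cover through `A`. General position need only be arranged on one lift
`a₀ t` of each tetrahedron; equivariance carries it to the others. -/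
theorem exists_isVertexDecoration [PathConnectedSpace M] [Finite Tet] (hT : T.IsSimplicial)
    {x₀ : M} (ρ : FundamentalGroup M x₀ →* PSL(2, ℂ)) (A : FundamentalGroup M x₀ → SL(2, ℂ))
    (hA : ∀ γ, (A γ : PSL(2, ℂ)) = ρ γ) :
    ∃ W : UniversalCover M x₀ → Fin 2 → ℂ, T.IsVertexDecoration A W := by
  let base (y : M) : UniversalCover M x₀ :=
    ⟨y, Path.Homotopic.Quotient.mk (PathConnectedSpace.somePath x₀ y)⟩
  choose deck hdeck using fun p : UniversalCover M x₀ =>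
    UniversalCover.exists_smul_eq (base p.1) p rfl
  choose a₀ _ using fun t => T.exists_liftSimplex_eq t (stdSimplex.vertex 0)
    (base (T.proj ⟨t, stdSimplex.vertex 0⟩)) rfl
  obtain ⟨v, hv⟩ := exists_vectors_det2_ne_zero
    (J := Tet × {p : Fin 4 × Fin 4 // p.1 ≠ p.2})
    (fun j => (T.liftVertex j.1 (a₀ j.1) j.2.1.1).1)
    (fun j => (T.liftVertex j.1 (a₀ j.1) j.2.1.2).1)
    (fun j => A (deck (T.liftVertex j.1 (a₀ j.1) j.2.1.1)))
    (fun j => A (deck (T.liftVertex j.1 (a₀ j.1) j.2.1.2)))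
    (fun j h => j.2.2 (hT j.1 h))
  have heq (γ : FundamentalGroup M x₀) (p : UniversalCover M x₀) : ∃ c : ℂ, (c = 1 ∨ c = -1) ∧
      (A (deck (γ • p))).1.mulVec (v (γ • p).1) =
        c • (A γ).1.mulVec ((A (deck p)).1.mulVec (v p.1)) := by
    -- Freeness makes the translating element equivariant. Since `A` lifts a homomorphism to `PSL(2,
    -- ℂ)`, it is multiplicative up to sign.
    have h1 : deck (γ • p) = γ * deck p := by
      refine UniversalCover.smul_left_cancel_point (p := base p.1) ?_
      rw [mul_smul, hdeck p]
      exact hdeck (γ • p)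
    obtain ⟨c, hc, h⟩ := sl_eq_or_eq_neg_of_coe_eq (A := A γ * A (deck p))
      (B := A (deck (γ • p))) (by
        rw [QuotientGroup.mk_mul, hA, hA, hA, h1, map_mul])
    refine ⟨c, hc, ?_⟩
    rw [h, UniversalCover.smul_fst, Matrix.smul_mulVec, Matrix.mulVec_mulVec]
    rfl
  refine ⟨fun p => (A (deck p)).1.mulVec (v p.1), heq, ?_⟩
  intro t a i j hij
  obtain ⟨γ, hγ⟩ := T.exists_smul_liftSimplex t (a₀ t) a
  obtain ⟨c, hc, h⟩ := heq γ (T.liftVertex t (a₀ t) i)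
  obtain ⟨d, hd, h'⟩ := heq γ (T.liftVertex t (a₀ t) j)
  have hi : T.liftVertex t a i = γ • T.liftVertex t (a₀ t) i := hγ _
  have hj : T.liftVertex t a j = γ • T.liftVertex t (a₀ t) j := hγ _
  rw [hi, hj, h, h', det2_smul_smul, det2_mulVec_sl]
  refine mul_ne_zero (mul_ne_zero ?_ ?_) (hv (t, ⟨(i, j), hij⟩))
  · rcases hc with rfl | rfl <;> simp
  · rcases hd with rfl | rfl <;> simp

namespace IsVertexDecoration

variable {T} {x₀ : M} {A : FundamentalGroup M x₀ → SL(2, ℂ)}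
  {W : UniversalCover M x₀ → Fin 2 → ℂ}

theorem ne_zero (hW : T.IsVertexDecoration A W) (t : Tet) (a : Path.Homotopic.Quotient x₀ (T.charMap t (stdSimplex.vertex 0)))
    (i : Fin 4) : W (T.liftVertex t a i) ≠ 0 := by
  intro h
  obtain ⟨j, hj⟩ := exists_ne i
  refine hW.general_position t a i j hj.symm ?_
  rw [h]
  simp [det2]

/-- Passing to another lift applies one matrix of `SL(2, ℂ)` to all four vectors, up to individual
signs. Hence the shape belongs to the tetrahedron of `M`. -/
theorem crossRatio_congr (hW : T.IsVertexDecoration A W) (t : Tet)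
    (a a' : Path.Homotopic.Quotient x₀ (T.charMap t (stdSimplex.vertex 0))) (i j k l : Fin 4) :
    crossRatio (W (T.liftVertex t a' i)) (W (T.liftVertex t a' j)) (W (T.liftVertex t a' k))
        (W (T.liftVertex t a' l)) =
      crossRatio (W (T.liftVertex t a i)) (W (T.liftVertex t a j)) (W (T.liftVertex t a k))
        (W (T.liftVertex t a l)) := by
  obtain ⟨γ, hγ⟩ := T.exists_smul_liftSimplex t a a'
  have h (i : Fin 4) : ∃ c : ℂ, c ≠ 0 ∧
      W (T.liftVertex t a' i) = c • (A γ).1.mulVec (W (T.liftVertex t a i)) := by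
    obtain ⟨c, hc, h⟩ := hW.equivariant γ (T.liftVertex t a i)
    refine ⟨c, by rcases hc with rfl | rfl <;> simp, ?_⟩
    rw [← h]
    exact congrArg W (hγ _)
  choose c hc hcW using h
  rw [hcW, hcW, hcW, hcW,
    crossRatio_smul hc (fun i => (A γ).1.mulVec (W (T.liftVertex t a i))), crossRatio_mulVec]

end IsVertexDecoration

/-! ### Flags around an edge and the edge equation. -/

/-- Rotation about the first edge of a flag into the neighbouring tetrahedron. -/
def rotateFlag (f : Tet × Equiv.Perm (Fin 4)) : Tet × Equiv.Perm (Fin 4) :=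
  (T.adj f.1 (f.2 3), T.glue f.1 (f.2 3) * f.2 * Equiv.swap 2 3)

theorem rotateFlag_fst (f : Tet × Equiv.Perm (Fin 4)) :
    (T.rotateFlag f).1 = T.adj f.1 (f.2 3) := rfl

theorem rotateFlag_zero (f : Tet × Equiv.Perm (Fin 4)) :
    (T.rotateFlag f).2 0 = T.glue f.1 (f.2 3) (f.2 0) := by
  have h : Equiv.swap (2 : Fin 4) 3 0 = 0 := by decide
  simp [rotateFlag, h]

theorem rotateFlag_one (f : Tet × Equiv.Perm (Fin 4)) :
    (T.rotateFlag f).2 1 = T.glue f.1 (f.2 3) (f.2 1) := by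
  have h : Equiv.swap (2 : Fin 4) 3 1 = 1 := by decide
  simp [rotateFlag, h]

theorem rotateFlag_two (f : Tet × Equiv.Perm (Fin 4)) :
    (T.rotateFlag f).2 2 = T.glue f.1 (f.2 3) (f.2 3) := by
  simp [rotateFlag]

theorem rotateFlag_three (f : Tet × Equiv.Perm (Fin 4)) :
    (T.rotateFlag f).2 3 = T.glue f.1 (f.2 3) (f.2 2) := by
  simp [rotateFlag]

theorem rotateFlag_injective : Function.Injective T.rotateFlag := by
  -- Rotation backwards: the face just crossed is now opposite the vertex in position `2`.
  let g (f : Tet × Equiv.Perm (Fin 4)) : Tet × Equiv.Perm (Fin 4) :=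
    (T.adj f.1 (f.2 2), T.glue f.1 (f.2 2) * f.2 * Equiv.swap 2 3)
  have hg : Function.LeftInverse g T.rotateFlag := by
    intro f
    simp only [g, T.rotateFlag_two, T.rotateFlag_fst, T.adj_adj, T.glue_glue]
    simp [rotateFlag, mul_assoc]
  exact hg.injective

theorem proj_vertex_adj (t : Tet) {i j : Fin 4} (h : j ≠ i) :
    T.proj ⟨T.adj t i, stdSimplex.vertex (T.glue t i j)⟩ = T.proj ⟨t, stdSimplex.vertex j⟩ :=
  (T.proj_eq_of_face (vertex_eq_zero h) (vertex_glue _ j)).symm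

section EdgeEquation

variable [Fintype Tet]

open Classical in
/-- The flags at the edge `e`: even labellings of the vertices of a tetrahedron whose first two
vertices span `e`, positively oriented by a well-order of the points of `M`. -/
noncomputable def edgeFlags (e : T.Edge) : Finset (Tet × Equiv.Perm (Fin 4)) :=
  {f | Equiv.Perm.sign f.2 = 1 ∧
    WellOrderingRel (T.proj ⟨f.1, stdSimplex.vertex (f.2 0)⟩)
      (T.proj ⟨f.1, stdSimplex.vertex (f.2 1)⟩) ∧
    Quot.mk T.EdgeStep (f.1, firstEdge f.2) = e}

theorem mem_edgeFlags {e : T.Edge} {f : Tet × Equiv.Perm (Fin 4)} :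
    f ∈ T.edgeFlags e ↔ Equiv.Perm.sign f.2 = 1 ∧
      WellOrderingRel (T.proj ⟨f.1, stdSimplex.vertex (f.2 0)⟩)
        (T.proj ⟨f.1, stdSimplex.vertex (f.2 1)⟩) ∧
      Quot.mk T.EdgeStep (f.1, firstEdge f.2) = e := by
  simp [edgeFlags]

/-- Each tetrahedron edge identified to `e` carries exactly one flag: its ends are distinct in `M`,
so the well-order picks its direction, and an even labelling is determined by its first two
vertices. -/
theorem card_edgeFlags_filter [DecidableEq Tet] (hT : T.IsSimplicial) (e : T.Edge) (q : T.Quad) :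
    ((T.edgeFlags e).filter fun f => (f.1, facingQuad f.2) = q).card = T.index q e := by
  obtain ⟨t, k⟩ := q
  rw [← Set.ncard_coe_finset]
  refine Set.ncard_congr (fun f _ => firstEdge f.2) ?_ ?_ ?_
  · rintro ⟨t', σ⟩ hf
    obtain ⟨hf', hq⟩ := Finset.mem_filter.1 hf
    obtain ⟨rfl, rfl⟩ := Prod.mk.inj hq
    exact ⟨faces_facingQuad σ, (T.mem_edgeFlags.1 hf').2.2⟩
  · rintro ⟨t₁, σ⟩ ⟨t₂, τ⟩ hf hg h
    obtain ⟨hf', hq⟩ := Finset.mem_filter.1 hf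
    obtain ⟨hg', hq'⟩ := Finset.mem_filter.1 hg
    obtain rfl : t₁ = t := (Prod.mk.inj hq).1
    obtain rfl : t₂ = t₁ := (Prod.mk.inj hq').1
    obtain ⟨hσ, hσo, -⟩ := T.mem_edgeFlags.1 hf'
    obtain ⟨hτ, hτo, -⟩ := T.mem_edgeFlags.1 hg'
    dsimp only at hσ hσo hτ hτo
    have hs : ({σ 0, σ 1} : Finset (Fin 4)) = {τ 0, τ 1} := congrArg Subtype.val h
    have hs' : ({σ 0, σ 1} : Set (Fin 4)) = {τ 0, τ 1} := by
      have := congrArg (fun s : Finset (Fin 4) => (s : Set (Fin 4))) hs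
      simpa using this
    rcases Set.pair_eq_pair_iff.1 hs' with ⟨h0, h1⟩ | ⟨h0, h1⟩
    · rw [even_perm_ext σ τ hσ hτ h0 h1]
    · rw [h0, h1] at hσo
      exact absurd hτo (asymm hσo)
  · rintro ⟨s, hs⟩ ⟨hk, he⟩
    have key : ∀ a b, a ≠ b → s = {a, b} →
        WellOrderingRel (T.proj ⟨t, stdSimplex.vertex a⟩) (T.proj ⟨t, stdSimplex.vertex b⟩) →
        ∃ f, ∃ _ : f ∈ (↑((T.edgeFlags e).filter fun f => (f.1, facingQuad f.2) = (t, k)) :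
          Set (Tet × Equiv.Perm (Fin 4))), firstEdge f.2 = ⟨s, hs⟩ := by
      intro a b hab hsab hr
      obtain ⟨σ, hσ, rfl, rfl⟩ := exists_even_perm a b hab
      have hfe : firstEdge σ = ⟨s, hs⟩ := Subtype.ext hsab.symm
      refine ⟨(t, σ), Finset.mem_coe.2 (Finset.mem_filter.2
        ⟨T.mem_edgeFlags.2 ⟨hσ, hr, ?_⟩, ?_⟩), hfe⟩
      · dsimp only
        rw [hfe, he]
      · dsimp only
        rw [← eq_facingQuad (σ := σ) (k := k) (by rw [hfe]; exact hk)]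
    obtain ⟨a, b, hab, hsab⟩ := Finset.card_eq_two.1 hs
    rcases trichotomous_of WellOrderingRel (T.proj ⟨t, stdSimplex.vertex a⟩)
      (T.proj ⟨t, stdSimplex.vertex b⟩) with h | h | h
    · exact key a b hab hsab h
    · exact absurd (hT t h) hab
    · exact key b a hab.symm (by rw [hsab, Finset.pair_comm]) h

theorem prod_pow_index (hT : T.IsSimplicial) (Z : T.Quad → ℂ) (e : T.Edge) :
    ∏ q : T.Quad, Z q ^ T.index q e = ∏ f ∈ T.edgeFlags e, Z (f.1, facingQuad f.2) := by
  classical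
  rw [← Finset.prod_fiberwise_of_maps_to' (s := T.edgeFlags e) (t := Finset.univ)
    (g := fun f => ((f.1, facingQuad f.2) : T.Quad)) (fun _ _ => Finset.mem_univ _) Z]
  refine Finset.prod_congr rfl fun q _ => ?_
  rw [Finset.prod_const, T.card_edgeFlags_filter hT]

theorem rotateFlag_mem {e : T.Edge} {f : Tet × Equiv.Perm (Fin 4)} (hf : f ∈ T.edgeFlags e) :
    T.rotateFlag f ∈ T.edgeFlags e := by
  obtain ⟨hσ, hr, he⟩ := T.mem_edgeFlags.1 hf
  refine T.mem_edgeFlags.2 ⟨?_, ?_, ?_⟩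
  -- The gluing permutation and the swap are both odd; this is where orientation reversal enters.
  · simp [rotateFlag, T.sign_glue, hσ]
  · rw [T.rotateFlag_zero, T.rotateFlag_one, T.rotateFlag_fst,
      T.proj_vertex_adj f.1 (f.2.injective.ne (by decide)),
      T.proj_vertex_adj f.1 (f.2.injective.ne (by decide))]
    exact hr
  · rw [← he]
    refine (Quot.sound ⟨f.2 3, ?_, rfl, ?_⟩).symm
    · simp [firstEdge]
    · simp only [firstEdge, T.rotateFlag_zero, T.rotateFlag_one]
      simp [Finset.map_insert]

/-- An injective self-map of a finite set is a permutation. It need not be known that the flags form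
a single cycle. -/
theorem prod_rotateFlag (e : T.Edge) (F : Tet × Equiv.Perm (Fin 4) → ℂ) :
    ∏ f ∈ T.edgeFlags e, F (T.rotateFlag f) = ∏ f ∈ T.edgeFlags e, F f := by
  have hm : Set.MapsTo T.rotateFlag (T.edgeFlags e) (T.edgeFlags e) :=
    fun f hf => T.rotateFlag_mem hf
  exact Finset.prod_nbij T.rotateFlag hm T.rotateFlag_injective.injOn
    (Finset.surjOn_of_injOn_of_card_le _ hm T.rotateFlag_injective.injOn le_rfl) fun _ _ => rfl

/-- The shape parameters around an edge multiply to `1`. -/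
theorem IsVertexDecoration.prod_edgeFlags {x₀ : M} [PathConnectedSpace M]
    {A : FundamentalGroup M x₀ → SL(2, ℂ)} {W : UniversalCover M x₀ → Fin 2 → ℂ}
    (hW : T.IsVertexDecoration A W) {Z : T.Quad → ℂ}
    (hZ : ∀ t a (σ : Equiv.Perm (Fin 4)), Equiv.Perm.sign σ = 1 →
      Z (t, facingQuad σ) = crossRatio (W (T.liftVertex t a (σ 0))) (W (T.liftVertex t a (σ 1)))
        (W (T.liftVertex t a (σ 2))) (W (T.liftVertex t a (σ 3)))) (e : T.Edge) :
    ∏ f ∈ T.edgeFlags e, Z (f.1, facingQuad f.2) = 1 := by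
  let base (y : M) : UniversalCover M x₀ :=
    ⟨y, Path.Homotopic.Quotient.mk (PathConnectedSpace.somePath x₀ y)⟩
  -- Each flag is lifted with its initial vertex at a point depending only on the image in `M`.
  -- Rotation preserves that image, so a flag and its rotation have lifts sharing a face.
  choose a ha using fun f : Tet × Equiv.Perm (Fin 4) =>
    T.exists_liftSimplex_eq f.1 (stdSimplex.vertex (f.2 0))
      (base (T.proj ⟨f.1, stdSimplex.vertex (f.2 0)⟩)) rfl
  -- The cross-ratio of a flag is `F f 2 / F f 3`, and rotation moves the vertex in position `2` to
  -- position `3`, so the product telescopes.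
  let F (f : Tet × Equiv.Perm (Fin 4)) (i : Fin 4) : ℂ :=
    det2 (W (T.liftVertex f.1 (a f) (f.2 0))) (W (T.liftVertex f.1 (a f) (f.2 i))) /
      det2 (W (T.liftVertex f.1 (a f) (f.2 1))) (W (T.liftVertex f.1 (a f) (f.2 i)))
  have hF0 (f) : F f 3 ≠ 0 :=
    div_ne_zero (hW.general_position _ _ _ _ (by simp)) (hW.general_position _ _ _ _ (by simp))
  have hF (f) : F (T.rotateFlag f) 3 = F f 2 := by
    have h03 : f.2 0 ≠ f.2 3 := f.2.injective.ne (by decide)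
    have h13 : f.2 1 ≠ f.2 3 := f.2.injective.ne (by decide)
    have h23 : f.2 2 ≠ f.2 3 := f.2.injective.ne (by decide)
    have hb := ha (T.rotateFlag f)
    rw [T.rotateFlag_zero] at hb
    have hp : base (T.proj ⟨f.1, stdSimplex.vertex (f.2 0)⟩) =
        base (T.proj ⟨(T.rotateFlag f).1, stdSimplex.vertex (T.glue f.1 (f.2 3) (f.2 0))⟩) :=
      congrArg base (T.proj_vertex_adj f.1 h03).symm
    have hl {j : Fin 4} (hj : j ≠ f.2 3) : T.liftVertex f.1 (a f) j =
        T.liftVertex (T.rotateFlag f).1 (a (T.rotateFlag f)) (T.glue f.1 (f.2 3) j) :=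
      T.liftVertex_eq_of_face (vertex_eq_zero h03) (vertex_glue _ (f.2 0))
        ((ha f).trans (hp.trans hb.symm)) hj
    simp only [F, T.rotateFlag_zero, T.rotateFlag_one, T.rotateFlag_three, hl h03, hl h13, hl h23]
  have hZF : ∀ f ∈ T.edgeFlags e, Z (f.1, facingQuad f.2) = F (T.rotateFlag f) 3 / F f 3 := by
    intro f hf
    rw [hF, hZ f.1 (a f) f.2 (T.mem_edgeFlags.1 hf).1]
    simp only [F, crossRatio]
    rw [div_mul_div_comm, div_div_div_eq]
    congr 1
    ring
  rw [Finset.prod_congr rfl hZF, Finset.prod_div_distrib, T.prod_rotateFlag e fun f => F f 3]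
  exact div_self (Finset.prod_ne_zero_iff.2 fun f _ => hF0 f)

end EdgeEquation

end OrientedTriangulation

/-! ### Parameters and the developing map. -/

namespace OrientedTriangulation

variable {Tet : Type*} {M : Type*} [TopologicalSpace M] (T : OrientedTriangulation Tet M)

theorem exists_parameter_of_isVertexDecoration [PathConnectedSpace M] [Fintype Tet]
    (hT : T.IsSimplicial) {x₀ : M} {A : FundamentalGroup M x₀ → SL(2, ℂ)}
    {W : UniversalCover M x₀ → Fin 2 → ℂ} (hW : T.IsVertexDecoration A W) :
    ∃ Z ∈ T.parameterSpace, ∀ t a (σ : Equiv.Perm (Fin 4)), Equiv.Perm.sign σ = 1 →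
      ∀ k : Fin 3, Faces k {σ 0, σ 1} →
      Z (t, k) = crossRatio (W (T.liftVertex t a (σ 0))) (W (T.liftVertex t a (σ 1)))
        (W (T.liftVertex t a (σ 2))) (W (T.liftVertex t a (σ 3))) := by
  choose a₀ _ using fun t => T.exists_liftSimplex_eq t (stdSimplex.vertex 0)
    (⟨T.proj ⟨t, stdSimplex.vertex 0⟩, Path.Homotopic.Quotient.mk
      (PathConnectedSpace.somePath x₀ _)⟩ : UniversalCover M x₀) rfl
  let w (t : Tet) (i : Fin 4) : Fin 2 → ℂ := W (T.liftVertex t (a₀ t) i)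
  have hw (t : Tet) {i j : Fin 4} (h : i ≠ j) : det2 (w t i) (w t j) ≠ 0 :=
    hW.general_position t (a₀ t) i j h
  let Z (q : T.Quad) : ℂ :=
    crossRatio (w q.1 0) (w q.1 q.2.succ) (w q.1 (q.2 + 1).succ) (w q.1 (q.2 + 2).succ)
  have hZ : ∀ t a (σ : Equiv.Perm (Fin 4)), Equiv.Perm.sign σ = 1 →
      ∀ k : Fin 3, Faces k {σ 0, σ 1} →
      Z (t, k) = crossRatio (W (T.liftVertex t a (σ 0))) (W (T.liftVertex t a (σ 1)))
        (W (T.liftVertex t a (σ 2))) (W (T.liftVertex t a (σ 3))) := by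
    intro t a σ hσ k hk
    rw [hW.crossRatio_congr t (a₀ t) a]
    exact (crossRatio_of_faces (w t) σ hσ k hk).symm
  have hne : ∀ k : Fin 3, k ≠ k + 1 ∧ k ≠ k + 2 ∧ k + 1 ≠ k + 2 := by decide
  refine ⟨Z, ⟨?_, ?_, ?_⟩, hZ⟩
  · rintro ⟨t, k⟩
    obtain ⟨h1, h2, h3⟩ := hne k
    have hs {i j : Fin 3} (h : i ≠ j) : det2 (w t i.succ) (w t j.succ) ≠ 0 :=
      hw t ((Fin.succ_injective _).ne h)
    have h0 (i : Fin 3) : det2 (w t 0) (w t i.succ) ≠ 0 := hw t (Fin.succ_ne_zero i).symm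
    refine ⟨mul_ne_zero (div_ne_zero (h0 _) (h0 _)) (div_ne_zero (hs h2) (hs h1)), fun h => ?_⟩
    have h' := one_sub_crossRatio (h0 (k + 2)) (hs h1)
    rw [show crossRatio (w t 0) (w t k.succ) (w t (k + 1).succ) (w t (k + 2).succ) = 1 from h,
      sub_self] at h'
    exact div_ne_zero (neg_ne_zero.2 (mul_ne_zero (h0 k) (hs h3)))
      (mul_ne_zero (h0 (k + 2)) (hs h1)) h'.symm
  · intro e
    rw [T.prod_pow_index hT]
    exact hW.prod_edgeFlags T
      (fun t a σ hσ => hZ t a σ hσ (facingQuad σ) (faces_facingQuad σ)) e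
  · intro t k
    have h3 : ∀ k : Fin 3, k + 1 + 1 = k + 2 ∧ k + 1 + 2 = k := by decide
    simp only [Z, (h3 k).1, (h3 k).2]
    exact crossRatio_cyclic (hw t (Fin.succ_ne_zero _).symm)
      (hw t ((Fin.succ_injective _).ne (hne k).1))

/-- The map is defined at each point by an arbitrary lifted simplex containing it;
`idealSum_liftVertex_congr` shows that the choice does not matter. -/
theorem isAssociatedRepresentation_of_isVertexDecoration {x₀ : M}
    (ρ : FundamentalGroup M x₀ →* PSL(2, ℂ)) {A : FundamentalGroup M x₀ → SL(2, ℂ)}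
    (hA : ∀ γ, (A γ : PSL(2, ℂ)) = ρ γ) {W : UniversalCover M x₀ → Fin 2 → ℂ}
    (hW : T.IsVertexDecoration A W) {Z : T.Quad → ℂ}
    (hZ : ∀ t a (σ : Equiv.Perm (Fin 4)), Equiv.Perm.sign σ = 1 →
      ∀ k : Fin 3, Faces k {σ 0, σ 1} →
      Z (t, k) = crossRatio (W (T.liftVertex t a (σ 0))) (W (T.liftVertex t a (σ 1)))
        (W (T.liftVertex t a (σ 2))) (W (T.liftVertex t a (σ 3)))) :
    T.IsAssociatedRepresentation x₀ Z ρ := by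
  choose s b y hs using T.exists_liftSimplex x₀
  let D (p : UniversalCover M x₀) : ClosedH3 :=
    idealSimplex (fun i => W (T.liftVertex (s p) (b p) i)) (hW.ne_zero (s p) (b p)) (y p)
  have hD (t a x) : D (T.liftSimplex t a x) =
      idealSimplex (fun i => W (T.liftVertex t a i)) (hW.ne_zero t a) x :=
    idealSimplex_congr _ _ (T.idealSum_liftVertex_congr W (hs _))
  refine ⟨D, fun t a => ⟨fun i => W (T.liftVertex t a i), hW.ne_zero t a,
    hW.general_position t a, hD t a, hZ t a⟩, fun γ p => ?_⟩
  obtain ⟨t, a, x, rfl⟩ := T.exists_liftSimplex x₀ p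
  rw [smul_liftSimplex, hD, hD, ← hA]
  refine smul_idealSimplex (A γ) _ _ ?_
  choose c hc hcW using fun i => hW.equivariant γ (T.liftVertex t a i)
  rw [← idealSum_mulVec (A γ) hc]
  congr 1
  funext i
  rw [← hcW, liftVertex, liftVertex, smul_liftSimplex]

end OrientedTriangulation

theorem mainTheorem2 {M : Type*} [TopologicalSpace M] [T2Space M] [CompactSpace M]
    [ConnectedSpace M] [ChartedSpace (EuclideanSpace ℝ (Fin 3)) M]
    {Tet : Type*} [Fintype Tet] (T : OrientedTriangulation Tet M) (hT : T.IsSimplicial)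
    (x₀ : M) (ρ : FundamentalGroup M x₀ →* PSL(2, ℂ)) :
    ∃ Z ∈ T.parameterSpace, T.IsAssociatedRepresentation x₀ Z ρ := by
  have : LocallyPathConnectedSpace M :=
    ChartedSpace.locallyPathConnectedSpace (EuclideanSpace ℝ (Fin 3)) M
  have : PathConnectedSpace M := pathConnectedSpace_iff_connectedSpace.2 inferInstance
  -- Only a set-theoretic lift is taken: `ρ` need not lift to a homomorphism into `SL(2, ℂ)`.
  choose A hA using fun γ => QuotientGroup.mk_surjective (ρ γ)
  obtain ⟨W, hW⟩ := T.exists_isVertexDecoration hT ρ A hA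
  obtain ⟨Z, hZ, hZW⟩ := T.exists_parameter_of_isVertexDecoration hT hW
  exact ⟨Z, hZ, T.isAssociatedRepresentation_of_isVertexDecoration ρ hA hW hZW⟩
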